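/- For $x\in\mathbb{C}$, $t\ge 0$ and $0<q<1$ let $$F(x,t;q)=\sum_{k=0}^{\infty}\frac{(-x)^k q^{\binom k2}}{(q;q)_k}\,e^{t(1-q^{-k})},\qquad (q;q)_k=\prod_{j=1}^{k}(1-q^j),$$ and let $\operatorname{Li}_2(x)=-\int_0^x\frac{\log(1-u)}{u}\,du$ be the principal branch of the dilogarithm on $\mathbb{C}\setminus[1,+\infty)$ (integral along the straight segment; $\log$ is the principal logarithm). Fix $t\ge 0$ and put $\varepsilon=-\log q$. (i) For every $x\in\mathbb{C}\setminus\big((-\infty,0]\cup[1,+\infty)\big)$, $$F(x,t;q)=\exp\Big[-\frac1\varepsilon\operatorname{Li}_2(x)+\frac12\log(1-x)+tx+O(\varepsilon)\Big],\qquad \varepsilon\to0^+ ,$$ where the constant implied by $O(\varepsilon)$ may depend on $x$ and $t$. (ii) The same formula holds as $x$ approaches zero at any angle $\phi\in(-\pi,\pi)$ with the positive real axis: for every $\phi\in(-\pi,\pi)$, as $x\to0$ with $x\neq0$, $\arg x\to\phi$, and $\varepsilon\to0^+$ (jointly, with no relation imposed between $x$ and $\varepsilon$), $$F(x,t;q)=\exp\Big[-\frac1\varepsilon\operatorname{Li}_2(x)+\frac12\log(1-x)+tx+O(\varepsilon)\Big],$$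 where the constant implied by $O(\varepsilon)$ depends only on $\phi$ and $t$. -/

import Mathlib

open Filter Topology Asymptotics

noncomputable section

/-- The finite `q`-Pochhammer symbol `(a;q)_n = ∏_{j=0}^{n-1} (1 - a q^j)`. -/
def qPoch (a q : ℂ) (n : ℕ) : ℂ := ∏ j ∈ Finset.range n, (1 - a * q ^ j)

/-- The `q`-series
`F(x,t;q) = ∑_{k ≥ 0} (-x)^k q^{k(k-1)/2} / (q;q)_k * e^{t (1 - q^{-k})}`. -/
def qF (x : ℂ) (t q : ℝ) : ℂ :=
  ∑' k : ℕ, (-x) ^ k * (q : ℂ) ^ (k.choose 2) / qPoch (q : ℂ) (q : ℂ) k *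
    Complex.exp ((t : ℂ) * (1 - ((q : ℂ) ^ k)⁻¹))

/-- The principal branch of the dilogarithm, `Li₂(x) = -∫₀ˣ log(1-u)/u du`, with the integral taken
along the straight segment `u = s x`, `0 ≤ s ≤ 1` (which avoids the cut `[1,∞)` of `log (1-u)`
whenever `x ∉ [1,∞)`). -/
def dilog (x : ℂ) : ℂ := -∫ s in (0 : ℝ)..1, Complex.log (1 - (s : ℂ) * x) / (s : ℂ)

/-- `-Li₂(x)/ε + (1/2) log(1-x) + t x`. -/
def mainExponent (x : ℂ) (t ε : ℝ) : ℂ :=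
  -(1 / (ε : ℂ)) * dilog x + (1 / 2 : ℂ) * Complex.log (1 - x) + (t : ℂ) * x

/-- The filter "`x → 0` at the angle `φ` with the positive real axis":
`x → 0`, `x ≠ 0`, `arg x → φ`. -/
def zeroAtAngle (φ : ℝ) : Filter ℂ := 𝓝[≠] (0 : ℂ) ⊓ comap Complex.arg (𝓝 φ)

end

/-!
Write `q = e^{-ε}` and let `P(x) = ∑ q^{k(k-1)/2} (-x)^k / (q;q)_k` (`eulerSeries`), which is the
infinite product `(x;q)_∞`. Expanding `exp (-t q^{-k})` to order `N` under the sum defining `F`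
and using `P(x q^{-n}) = P(x) ∏_{j=1}^n (1 - x q^{-j})` gives (`norm_qF_sub_le`)

`F(x,t;q) = e^t P(x) ∑_{n<N} (-t)^n/n! ∏_{j=1}^n (1 - x q^{-j}) + remainder`.

The infinite expansion diverges, but `N = ⌊1/ε⌋` is a good place to stop. There `q^{-N}` is still
bounded, so the products are `(1 - x)^n + O(ε n² A^n)` and the sum is `e^{-t(1-x)} + O(ε)`
(`norm_sum_prod_sub_exp_le`), which with the factor `e^t` produces `e^{tx}`. Since the Taylor
remainder of `e^{-u}` is at most `u^N/N!` for `u ≥ 0`, the remainder is at most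
`t^N/N! * exp (C/ε)`, and the factorial makes it negligible even against
`|P(x)| ≥ exp (-C/ε)` (`pow_div_factorial_mul_exp_le`).

The factor `P(x) = ∏ (1 - x q^n)` is a sum of logarithms in the exponent. The trapezoidal rule
with step `ε` for `f(v) = log (1 - x e^{-v})`, whose integral over `[0,∞)` is `-Li₂(x)`, gives
`P(x) = exp (-Li₂(x)/ε + log(1-x)/2 + O(ε))` (`norm_eulerSeries_mul_exp_sub_one_le`).

All constants depend on `x` only through upper bounds for `|x|` and lower bounds for `|1 - s x|`,
`0 ≤ s ≤ 1` (`exists_norm_qF_mul_exp_sub_one_le`). So the estimate holds at every point off the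
cut `[1,∞)`, and uniformly on the disc `|x| ≤ 1/2`, which gives the joint limit at every angle.
-/

noncomputable section

/-! ### Factorial estimates -/

theorem hasSum_pow_div_factorial_exp (b : ℝ) :
    HasSum (fun n : ℕ => b ^ n / (n.factorial : ℝ)) (Real.exp b) := by
  rw [Real.exp_eq_exp_ℝ]
  exact NormedSpace.expSeries_div_hasSum_exp b

/-- The Taylor remainder of the real exponential of order `N`, at a nonnegative point, is
exponentially small in `N`. -/
theorem exp_sub_sum_range_le {b : ℝ} (hb : 0 ≤ b) (N : ℕ) :
    Real.exp b - ∑ n ∈ Finset.range N, b ^ n / n.factorial ≤ Real.exp (2 * b) / 2 ^ N := by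
  have h3 := (hasSum_nat_add_iff' N).2 (hasSum_pow_div_factorial_exp b)
  have h4 := ((hasSum_nat_add_iff' N).2 (hasSum_pow_div_factorial_exp (2 * b))).div_const ((2 : ℝ) ^ N)
  refine (hasSum_le (fun n => ?_) h3 h4).trans ?_
  · rw [mul_pow, pow_add 2, le_div_iff₀ (by positivity), div_mul_eq_mul_div]
    have : (1 : ℝ) ≤ 2 ^ n := one_le_pow₀ (by norm_num)
    have h5 : 0 ≤ b ^ (n + N) * 2 ^ N := by positivity
    refine div_le_div_of_nonneg_right ?_ (by positivity)
    nlinarith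
  · gcongr
    have : 0 ≤ ∑ i ∈ Finset.range N, (2 * b) ^ i / (i.factorial : ℝ) :=
      Finset.sum_nonneg fun i _ => by positivity
    linarith

theorem pow_div_factorial_le_exp_div {b : ℝ} (hb : 0 ≤ b) (N : ℕ) :
    b ^ N / N.factorial ≤ Real.exp (2 * b) / 2 ^ N := by
  have := Real.pow_div_factorial_le_exp (2 * b) (by positivity) N
  rw [le_div_iff₀ (by positivity)]
  calc _ = (2 * b) ^ N / N.factorial := by rw [mul_pow]; ring
    _ ≤ _ := this

theorem one_div_two_pow_le {ε : ℝ} (hε : 0 < ε) {N : ℕ} (hN : 1 / ε ≤ N + 1) :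
    1 / (2 : ℝ) ^ N ≤ ε := by
  have h : ((N : ℝ) + 1) ≤ 2 ^ N := by
    exact_mod_cast Nat.lt_two_pow_self (n := N)
  rw [div_le_iff₀ (by positivity), ← div_le_iff₀' hε]
  linarith

/-- The Taylor remainders of `exp (-u)`, for `u ≥ 0`, alternate in sign. -/
theorem neg_one_pow_mul_exp_neg_sub_sum_nonneg (N : ℕ) : ∀ {u : ℝ}, 0 ≤ u →
    0 ≤ (-1) ^ N * (Real.exp (-u) - ∑ n ∈ Finset.range N, (-u) ^ n / n.factorial) := by
  induction N with
  | zero => intro u _; simpa using Real.exp_nonneg _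
  | succ N ih =>
    intro u hu
    have hd : ∀ v : ℝ, HasDerivAt (fun v : ℝ => (-1) ^ (N + 1) *
        (Real.exp (-v) - ∑ n ∈ Finset.range (N + 1), (-v) ^ n / n.factorial))
        ((-1) ^ N * (Real.exp (-v) - ∑ n ∈ Finset.range N, (-v) ^ n / n.factorial)) v := by
      intro v
      have h1 : HasDerivAt (fun v : ℝ => Real.exp (-v)) (-Real.exp (-v)) v := by
        simpa using (hasDerivAt_neg v).exp
      have h2 : HasDerivAt (fun v : ℝ => ∑ n ∈ Finset.range N,
          (-v) ^ (n + 1) / ((n + 1).factorial : ℝ))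
          (∑ n ∈ Finset.range N, -((-v) ^ n / (n.factorial : ℝ))) v := by
        refine HasDerivAt.fun_sum fun n _ => ?_
        have h3 := ((hasDerivAt_neg v).fun_pow (n + 1)).div_const ((n + 1).factorial : ℝ)
        refine h3.congr_deriv ?_
        rw [Nat.factorial_succ]
        push_cast
        have : (n.factorial : ℝ) ≠ 0 := by positivity
        have : (n : ℝ) + 1 ≠ 0 := by positivity
        field_simp
      have h4 := ((h1.fun_sub (h2.add_const 1)).const_mul ((-1 : ℝ) ^ (N + 1)))
      simp only [Finset.sum_range_succ' _ N, pow_zero, Nat.factorial_zero, Nat.cast_one, div_one]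
      refine h4.congr_deriv ?_
      rw [Finset.sum_neg_distrib, pow_succ]
      ring
    have hm : MonotoneOn (fun v : ℝ => (-1) ^ (N + 1) *
        (Real.exp (-v) - ∑ n ∈ Finset.range (N + 1), (-v) ^ n / n.factorial)) (Set.Ici 0) := by
      refine monotoneOn_of_hasDerivWithinAt_nonneg (convex_Ici 0)
        (fun v _ => (hd v).continuousAt.continuousWithinAt)
        (fun v _ => (hd v).hasDerivWithinAt) fun v hv => ?_
      rw [interior_Ici] at hv
      exact ih (le_of_lt hv)
    have := hm (Set.mem_Ici.2 le_rfl) (Set.mem_Ici.2 hu) hu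
    simpa [Finset.sum_range_succ'] using this

theorem abs_exp_neg_sub_sum_le (N : ℕ) {u : ℝ} (hu : 0 ≤ u) :
    |Real.exp (-u) - ∑ n ∈ Finset.range N, (-u) ^ n / n.factorial| ≤ u ^ N / N.factorial := by
  have h0 := neg_one_pow_mul_exp_neg_sub_sum_nonneg N hu
  have h1 := neg_one_pow_mul_exp_neg_sub_sum_nonneg (N + 1) hu
  rw [Finset.sum_range_succ, neg_pow u N, pow_succ] at h1
  have hs : ((-1 : ℝ) ^ N) * (-1) ^ N = 1 := by rw [← mul_pow]; simp
  have ha : |Real.exp (-u) - ∑ n ∈ Finset.range N, (-u) ^ n / n.factorial| =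
      (-1) ^ N * (Real.exp (-u) - ∑ n ∈ Finset.range N, (-u) ^ n / n.factorial) := by
    rw [← abs_of_nonneg h0, abs_mul]; simp
  rw [ha]
  linear_combination h1 + u ^ N / N.factorial * hs

/-! ### Euler's `q`-exponential series -/

/-- The coefficient `q^{k(k-1)/2} / (q;q)_k` of Euler's `q`-exponential series. -/
def eulerCoeff (q : ℝ) (k : ℕ) : ℂ := (q : ℂ) ^ k.choose 2 / qPoch q q k

/-- Euler's series `∑ q^{k(k-1)/2} (-x)^k / (q;q)_k`. Its sum is the infinite product
`(x;q)_∞`; of that, only the functional equation and the limit at `0` are used. -/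
def eulerSeries (q : ℝ) (x : ℂ) : ℂ := ∑' k : ℕ, eulerCoeff q k * (-x) ^ k

section qseries

variable {q : ℝ}

theorem one_sub_pow_ne_zero (hq0 : 0 < q) (hq1 : q < 1) (k : ℕ) :
    (1 - (q : ℂ) ^ (k + 1)) ≠ 0 := by
  have : q ^ (k + 1) < 1 := pow_lt_one₀ hq0.le hq1 (by simp)
  have h : (1 - q ^ (k + 1) : ℝ) ≠ 0 := by linarith
  exact_mod_cast h

theorem eulerCoeff_zero : eulerCoeff q 0 = 1 := by simp [eulerCoeff, qPoch]

theorem eulerCoeff_succ (hq0 : 0 < q) (hq1 : q < 1) (k : ℕ) :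
    eulerCoeff q (k + 1) * (1 - (q : ℂ) ^ (k + 1)) = eulerCoeff q k * (q : ℂ) ^ k := by
  have h := one_sub_pow_ne_zero hq0 hq1 k
  have hq : qPoch q q k ≠ 0 := Finset.prod_ne_zero_iff.2 fun j _ => by
    have := one_sub_pow_ne_zero hq0 hq1 j
    rwa [pow_succ'] at this
  rw [eulerCoeff, eulerCoeff, qPoch, Finset.prod_range_succ, ← qPoch, ← pow_succ',
    Nat.choose_succ_succ' k 1, Nat.choose_one_right, pow_add]
  field_simp

theorem norm_eulerCoeff_le (hq0 : 0 < q) (hq1 : q < 1) (k : ℕ) :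
    ‖eulerCoeff q k‖ ≤ (1 / (1 - q)) ^ k / k.factorial := by
  have h1q : 0 < 1 - q := by linarith
  induction k with
  | zero => simp [eulerCoeff_zero]
  | succ k ih =>
    have hlt : q ^ (k + 1) < 1 := pow_lt_one₀ hq0.le hq1 (by simp)
    have h := congrArg norm (eulerCoeff_succ hq0 hq1 k)
    have hn : ‖(1 - (q : ℂ) ^ (k + 1))‖ = 1 - q ^ (k + 1) := by
      rw [show (1 - (q : ℂ) ^ (k + 1)) = ((1 - q ^ (k + 1) : ℝ) : ℂ) by push_cast; rfl,
        Complex.norm_real, Real.norm_of_nonneg (by linarith)]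
    rw [norm_mul, norm_mul, hn, norm_pow, Complex.norm_real, Real.norm_of_nonneg hq0.le] at h
    have hg : ((k : ℝ) + 1) * q ^ k * (1 - q) ≤ 1 - q ^ (k + 1) := by
      rw [← geom_sum_mul_neg]
      gcongr
      calc ((k : ℝ) + 1) * q ^ k = ∑ i ∈ Finset.range (k + 1), q ^ k := by simp
        _ ≤ _ := Finset.sum_le_sum fun i hi =>
          pow_le_pow_of_le_one hq0.le hq1.le (by simpa [Nat.lt_succ_iff] using hi)
    have hk : 0 < q ^ k := by positivity
    have h2 : ‖eulerCoeff q (k + 1)‖ * (((k : ℝ) + 1) * (1 - q)) ≤ ‖eulerCoeff q k‖ := by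
      refine le_of_mul_le_mul_right ?_ hk
      rw [← h]
      have := mul_le_mul_of_nonneg_left hg (norm_nonneg (eulerCoeff q (k + 1)))
      linarith
    rw [← le_div_iff₀ (by positivity)] at h2
    refine h2.trans ((div_le_div_of_nonneg_right ih (by positivity)).trans_eq ?_)
    rw [Nat.factorial_succ]
    push_cast
    rw [pow_succ]
    field_simp

theorem norm_eulerCoeff_mul_pow_le (hq0 : 0 < q) (hq1 : q < 1) (x : ℂ) (k : ℕ) :
    ‖eulerCoeff q k * (-x) ^ k‖ ≤ (‖x‖ / (1 - q)) ^ k / k.factorial := by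
  rw [norm_mul, norm_pow, norm_neg]
  calc _ ≤ (1 / (1 - q)) ^ k / k.factorial * ‖x‖ ^ k := by
        gcongr; exact norm_eulerCoeff_le hq0 hq1 k
    _ = _ := by rw [div_pow, div_pow, one_pow]; ring

theorem summable_eulerCoeff_mul_pow (hq0 : 0 < q) (hq1 : q < 1) (x : ℂ) :
    Summable fun k : ℕ => eulerCoeff q k * (-x) ^ k :=
  Summable.of_norm_bounded (Real.summable_pow_div_factorial _)
    (norm_eulerCoeff_mul_pow_le hq0 hq1 x)

theorem eulerSeries_eq_mul (hq0 : 0 < q) (hq1 : q < 1) (x : ℂ) :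
    eulerSeries q x = (1 - x) * eulerSeries q (x * q) := by
  have hs := summable_eulerCoeff_mul_pow hq0 hq1
  have h : eulerSeries q x - eulerSeries q (x * q) = -x * eulerSeries q (x * q) := by
    rw [eulerSeries, eulerSeries, ← (hs x).tsum_sub (hs (x * q)),
      ((hs x).sub (hs (x * q))).tsum_eq_zero_add, ← tsum_mul_left]
    simp only [pow_zero, sub_self, zero_add]
    refine tsum_congr fun k => ?_
    have := eulerCoeff_succ hq0 hq1 k
    rw [← neg_mul, mul_pow, mul_pow]
    linear_combination (-x) ^ (k + 1) * this
  linear_combination h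

theorem eulerSeries_eq_prod_mul (hq0 : 0 < q) (hq1 : q < 1) (x : ℂ) (M : ℕ) :
    eulerSeries q x = (∏ n ∈ Finset.range M, (1 - x * q ^ n)) * eulerSeries q (x * q ^ M) := by
  induction M with
  | zero => simp
  | succ M ih =>
    rw [ih, Finset.prod_range_succ, eulerSeries_eq_mul hq0 hq1 (x * q ^ M), pow_succ]
    ring_nf

theorem eulerSeries_mul_inv_pow (hq0 : 0 < q) (hq1 : q < 1) (x : ℂ) (n : ℕ) :
    eulerSeries q (x * ((q : ℂ) ^ n)⁻¹) =
      (∏ j ∈ Finset.range n, (1 - x * ((q : ℂ) ^ (j + 1))⁻¹)) * eulerSeries q x := by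
  have hq : (q : ℂ) ≠ 0 := by exact_mod_cast hq0.ne'
  induction n with
  | zero => simp
  | succ n ih =>
    rw [eulerSeries_eq_mul hq0 hq1, show x * ((q : ℂ) ^ (n + 1))⁻¹ * q = x * ((q : ℂ) ^ n)⁻¹ by
      rw [pow_succ]; field_simp, ih, Finset.prod_range_succ]
    ring

theorem norm_eulerSeries_sub_one_le (hq0 : 0 < q) (hq1 : q < 1) (x : ℂ) :
    ‖eulerSeries q x - 1‖ ≤ Real.exp (‖x‖ / (1 - q)) - 1 := by
  have hs := summable_eulerCoeff_mul_pow hq0 hq1 x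
  have h2 := (hasSum_nat_add_iff' 1).2 (hasSum_pow_div_factorial_exp (‖x‖ / (1 - q)))
  rw [eulerSeries, hs.tsum_eq_zero_add]
  simp only [eulerCoeff_zero, pow_zero, mul_one, add_sub_cancel_left]
  simp only [Finset.sum_range_one, pow_zero, Nat.factorial_zero, Nat.cast_one, div_one] at h2
  exact tsum_of_norm_bounded h2 fun k => norm_eulerCoeff_mul_pow_le hq0 hq1 x (k + 1)

theorem tendsto_eulerSeries_mul_pow (hq0 : 0 < q) (hq1 : q < 1) (x : ℂ) :
    Tendsto (fun M : ℕ => eulerSeries q (x * q ^ M)) atTop (𝓝 1) := by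
  rw [tendsto_iff_norm_sub_tendsto_zero]
  refine squeeze_zero (fun _ => norm_nonneg _)
    (fun M => norm_eulerSeries_sub_one_le hq0 hq1 (x * q ^ M)) ?_
  have h : Tendsto (fun M : ℕ => Real.exp (‖x‖ * q ^ M / (1 - q)) - 1) atTop
      (𝓝 (Real.exp (‖x‖ * 0 / (1 - q)) - 1)) :=
    (((tendsto_pow_atTop_nhds_zero_of_lt_one hq0.le hq1).const_mul _).div_const _).rexp.sub_const _
  simpa [abs_of_pos hq0] using h

/-- Expanding `exp (-t q^{-k})` to order `N` writes `qF` as a finite combination of the values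
`eulerSeries q (x q^{-n})`, `n < N`, up to a multiple of `t ^ N / N!`. -/
theorem norm_qF_sub_le (hq0 : 0 < q) (hq1 : q < 1) {t : ℝ} (ht : 0 ≤ t) (x : ℂ) (N : ℕ) :
    ‖qF x t q - Complex.exp t * (eulerSeries q x * ∑ n ∈ Finset.range N,
        (-(t : ℂ)) ^ n / n.factorial * ∏ j ∈ Finset.range n, (1 - x * ((q : ℂ) ^ (j + 1))⁻¹))‖ ≤
      Real.exp t * (t ^ N / N.factorial * Real.exp (‖x‖ * (q ^ N)⁻¹ / (1 - q))) := by
  set R : ℕ → ℝ := fun k => Real.exp (-(t * (q ^ k)⁻¹)) -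
    ∑ n ∈ Finset.range N, (-(t * (q ^ k)⁻¹)) ^ n / n.factorial with hR
  have hRb : ∀ k, |R k| ≤ t ^ N / N.factorial * ((q ^ N)⁻¹) ^ k := fun k => by
    refine (abs_exp_neg_sub_sum_le N (u := t * (q ^ k)⁻¹) (by positivity)).trans_eq ?_
    rw [mul_pow, inv_pow, inv_pow, ← pow_mul, ← pow_mul, mul_comm k N]; ring
  have hterm : ∀ k, (-x) ^ k * (q : ℂ) ^ k.choose 2 / qPoch q q k *
      Complex.exp ((t : ℂ) * (1 - ((q : ℂ) ^ k)⁻¹)) = Complex.exp t *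
        (∑ n ∈ Finset.range N, (-(t : ℂ)) ^ n / n.factorial *
          (eulerCoeff q k * (-(x * ((q : ℂ) ^ n)⁻¹)) ^ k) + eulerCoeff q k * (-x) ^ k * R k) := by
    intro k
    have he : Complex.exp ((t : ℂ) * (1 - ((q : ℂ) ^ k)⁻¹)) = Complex.exp t *
        (∑ n ∈ Finset.range N, (-(t * ((q : ℂ) ^ k)⁻¹)) ^ n / n.factorial + R k) := by
      simp only [hR]
      push_cast
      rw [add_sub_cancel, ← Complex.exp_add]
      ring_nf
    have hs : ∑ n ∈ Finset.range N, (-(t : ℂ)) ^ n / n.factorial *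
        (eulerCoeff q k * (-(x * ((q : ℂ) ^ n)⁻¹)) ^ k) =
        eulerCoeff q k * (-x) ^ k *
          ∑ n ∈ Finset.range N, (-(t * ((q : ℂ) ^ k)⁻¹)) ^ n / n.factorial := by
      rw [Finset.mul_sum]
      refine Finset.sum_congr rfl fun n _ => ?_
      rw [← neg_mul, ← neg_mul, mul_pow, mul_pow, inv_pow, inv_pow, ← pow_mul, ← pow_mul,
        mul_comm k n]
      ring
    rw [he, hs, eulerCoeff]
    generalize ∑ n ∈ Finset.range N, (-(t * ((q : ℂ) ^ k)⁻¹)) ^ n / (n.factorial : ℂ) = T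
    ring
  have hrem : ∀ k, ‖eulerCoeff q k * (-x) ^ k * R k‖ ≤
      t ^ N / N.factorial * ((‖x‖ * (q ^ N)⁻¹ / (1 - q)) ^ k / k.factorial) := fun k => by
    rw [norm_mul, Complex.norm_real, Real.norm_eq_abs]
    calc _ ≤ (‖x‖ / (1 - q)) ^ k / k.factorial * (t ^ N / N.factorial * ((q ^ N)⁻¹) ^ k) :=
          mul_le_mul (norm_eulerCoeff_mul_pow_le hq0 hq1 x k) (hRb k) (abs_nonneg _)
            ((norm_nonneg _).trans (norm_eulerCoeff_mul_pow_le hq0 hq1 x k))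
      _ = _ := by rw [mul_div_right_comm, mul_pow]; ring
  have h1 := (hasSum_pow_div_factorial_exp (‖x‖ * (q ^ N)⁻¹ / (1 - q))).mul_left
    (t ^ N / N.factorial)
  have hsum : Summable fun k => eulerCoeff q k * (-x) ^ k * (R k : ℂ) :=
    Summable.of_norm_bounded h1.summable hrem
  have hmain : HasSum (fun k => ∑ n ∈ Finset.range N, (-(t : ℂ)) ^ n / n.factorial *
      (eulerCoeff q k * (-(x * ((q : ℂ) ^ n)⁻¹)) ^ k))
      (∑ n ∈ Finset.range N, (-(t : ℂ)) ^ n / n.factorial *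
        eulerSeries q (x * ((q : ℂ) ^ n)⁻¹)) :=
    hasSum_sum fun n _ => (summable_eulerCoeff_mul_pow hq0 hq1 _).hasSum.mul_left _
  have hq : qF x t q = Complex.exp t * (∑ n ∈ Finset.range N, (-(t : ℂ)) ^ n / n.factorial *
      eulerSeries q (x * ((q : ℂ) ^ n)⁻¹) + ∑' k, eulerCoeff q k * (-x) ^ k * (R k : ℂ)) := by
    rw [qF, ← ((hmain.add hsum.hasSum).mul_left (Complex.exp t)).tsum_eq]
    exact tsum_congr hterm
  have hS : ∑ n ∈ Finset.range N, (-(t : ℂ)) ^ n / n.factorial *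
      eulerSeries q (x * ((q : ℂ) ^ n)⁻¹) = eulerSeries q x * ∑ n ∈ Finset.range N,
        (-(t : ℂ)) ^ n / n.factorial *
          ∏ j ∈ Finset.range n, (1 - x * ((q : ℂ) ^ (j + 1))⁻¹) := by
    rw [Finset.mul_sum]
    refine Finset.sum_congr rfl fun n _ => ?_
    rw [eulerSeries_mul_inv_pow hq0 hq1]
    ring
  rw [hq, hS, mul_add, add_sub_cancel_left, norm_mul, Complex.norm_exp_ofReal]
  gcongr
  exact tsum_of_norm_bounded h1 hrem

end qseries

/-! ### The dilogarithm along a ray -/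

section dilogarithm

variable {x : ℂ} {d : ℝ}

theorem one_sub_mem_slitPlane (hd : 0 < d)
    (hx : ∀ s ∈ Set.Icc (0 : ℝ) 1, d ≤ ‖1 - (s : ℂ) * x‖) {s : ℝ} (hs : s ∈ Set.Icc (0 : ℝ) 1) :
    1 - (s : ℂ) * x ∈ Complex.slitPlane := by
  by_contra h
  rw [Complex.mem_slitPlane_iff, not_or, not_lt, not_ne_iff] at h
  obtain ⟨h1, h2⟩ := h
  simp only [Complex.sub_re, Complex.one_re, Complex.mul_re, Complex.ofReal_re,
    Complex.ofReal_im, zero_mul, sub_zero, Complex.sub_im, Complex.one_im, Complex.mul_im,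
    zero_sub, add_zero, neg_eq_zero, mul_eq_zero] at h1 h2
  have hs0 : s ≠ 0 := by rintro rfl; norm_num at h1
  have hspos : 0 < s := lt_of_le_of_ne hs.1 hs0.symm
  have him : x.im = 0 := h2.resolve_left hs0
  -- `x` is real and at least `1`, so the segment from `1` to `1 - x` passes through `0`.
  have hre : 1 ≤ x.re := by nlinarith [hs.2]
  have hx1 : x = (x.re : ℂ) := Complex.ext (by simp) (by simp [him])
  have h3 := hx (x.re)⁻¹ ⟨by positivity, inv_le_one_of_one_le₀ hre⟩
  have h4 : ((x.re)⁻¹ : ℝ) * x = 1 := by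
    rw [hx1, Complex.ofReal_re, ← Complex.ofReal_mul, inv_mul_cancel₀ (by linarith)]; simp
  rw [h4] at h3
  simp at h3
  linarith

theorem hasDerivAt_log_one_sub_mul {s : ℝ} (hs : 1 - (s : ℂ) * x ∈ Complex.slitPlane) :
    HasDerivAt (fun u : ℝ => Complex.log (1 - (u : ℂ) * x)) (-x / (1 - (s : ℂ) * x)) s := by
  have h : HasDerivAt (fun u : ℝ => 1 - (u : ℂ) * x) (-x) s := by
    simpa using ((Complex.ofRealCLM.hasDerivAt (x := s)).mul_const x).const_sub 1
  exact h.clog_real hs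

theorem norm_log_one_sub_mul_le (hd : 0 < d)
    (hx : ∀ s ∈ Set.Icc (0 : ℝ) 1, d ≤ ‖1 - (s : ℂ) * x‖) {s : ℝ} (hs : s ∈ Set.Icc (0 : ℝ) 1) :
    ‖Complex.log (1 - (s : ℂ) * x)‖ ≤ ‖x‖ / d * s := by
  have := Convex.norm_image_sub_le_of_norm_hasDerivWithin_le
    (f := fun u : ℝ => Complex.log (1 - (u : ℂ) * x)) (f' := fun u : ℝ => -x / (1 - (u : ℂ) * x))
    (s := Set.Icc 0 1) (C := ‖x‖ / d) (x := 0) (y := s)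
    (fun u hu => (hasDerivAt_log_one_sub_mul (one_sub_mem_slitPlane hd hx hu)).hasDerivWithinAt)
    (fun u hu => by
      rw [norm_div, norm_neg]
      exact div_le_div_of_nonneg_left (norm_nonneg _) hd (hx u hu)) (convex_Icc 0 1)
    ⟨le_rfl, zero_le_one⟩ hs
  simpa [abs_of_nonneg hs.1] using this

theorem norm_log_one_sub_mul_div_le (hd : 0 < d)
    (hx : ∀ s ∈ Set.Icc (0 : ℝ) 1, d ≤ ‖1 - (s : ℂ) * x‖) {s : ℝ} (hs : s ∈ Set.Icc (0 : ℝ) 1) :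
    ‖Complex.log (1 - (s : ℂ) * x) / (s : ℂ)‖ ≤ ‖x‖ / d := by
  rcases eq_or_lt_of_le hs.1 with rfl | h0
  · simp; positivity
  · rw [norm_div, Complex.norm_real, Real.norm_of_nonneg hs.1, div_le_iff₀ h0]
    exact norm_log_one_sub_mul_le hd hx hs

theorem dilog_ofReal_mul {u : ℝ} (hu : u ≠ 0) :
    dilog ((u : ℂ) * x) = -∫ s in (0 : ℝ)..u, Complex.log (1 - (s : ℂ) * x) / (s : ℂ) := by
  have h := intervalIntegral.integral_comp_mul_left (a := 0) (b := 1)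
    (fun s : ℝ => Complex.log (1 - (s : ℂ) * x) / (s : ℂ)) hu
  rw [mul_zero, mul_one, eq_inv_smul_iff₀ hu, ← intervalIntegral.integral_smul] at h
  rw [dilog, ← h]
  congr 1
  refine intervalIntegral.integral_congr fun s _ => ?_
  have hu' : (u : ℂ) ≠ 0 := by exact_mod_cast hu
  simp only [Complex.real_smul, Complex.ofReal_mul]
  rw [← mul_assoc, mul_comm (s : ℂ) u, ← mul_div_assoc, mul_div_mul_left _ _ hu']

theorem norm_dilog_ofReal_mul_le (hd : 0 < d)
    (hx : ∀ s ∈ Set.Icc (0 : ℝ) 1, d ≤ ‖1 - (s : ℂ) * x‖) {u : ℝ} (hu0 : 0 < u) (hu1 : u ≤ 1) :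
    ‖dilog ((u : ℂ) * x)‖ ≤ ‖x‖ / d * u := by
  rw [dilog_ofReal_mul hu0.ne', norm_neg]
  have := intervalIntegral.norm_integral_le_of_norm_le_const (a := 0) (b := u) (C := ‖x‖ / d)
    (f := fun s : ℝ => Complex.log (1 - (s : ℂ) * x) / (s : ℂ)) (fun s hs => by
      rw [Set.uIoc_of_le hu0.le] at hs
      exact norm_log_one_sub_mul_div_le hd hx ⟨hs.1.le, hs.2.trans hu1⟩)
  simpa [abs_of_pos hu0] using this

theorem hasDerivAt_dilog_ofReal_mul (hd : 0 < d)
    (hx : ∀ s ∈ Set.Icc (0 : ℝ) 1, d ≤ ‖1 - (s : ℂ) * x‖) {u : ℝ} (hu0 : 0 < u) (hu1 : u ≤ 1) :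
    HasDerivAt (fun u : ℝ => dilog ((u : ℂ) * x)) (-(Complex.log (1 - (u : ℂ) * x) / (u : ℂ)))
      u := by
  have hm : Measurable fun s : ℝ => Complex.log (1 - (s : ℂ) * x) / (s : ℂ) := by fun_prop
  have hint : IntervalIntegrable (fun s : ℝ => Complex.log (1 - (s : ℂ) * x) / (s : ℂ))
      MeasureTheory.volume 0 u := by
    rw [intervalIntegrable_iff_integrableOn_Ioc_of_le hu0.le]
    refine MeasureTheory.IntegrableOn.of_bound (C := ‖x‖ / d) (by simp)
      hm.aestronglyMeasurable ?_
    refine (MeasureTheory.ae_restrict_iff' measurableSet_Ioc).2 (Eventually.of_forall fun s hs => ?_)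
    exact norm_log_one_sub_mul_div_le hd hx ⟨hs.1.le, hs.2.trans hu1⟩
  have hc : ContinuousAt (fun s : ℝ => Complex.log (1 - (s : ℂ) * x) / (s : ℂ)) u :=
    (hasDerivAt_log_one_sub_mul
      (one_sub_mem_slitPlane hd hx ⟨hu0.le, hu1⟩)).continuousAt.div
      Complex.continuous_ofReal.continuousAt (by exact_mod_cast hu0.ne')
  refine (intervalIntegral.integral_hasDerivAt_right hint
    hm.stronglyMeasurable.stronglyMeasurableAtFilter hc).fun_neg.congr_of_eventuallyEq ?_
  filter_upwards [lt_mem_nhds hu0] with s hs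
  exact dilog_ofReal_mul hs.ne'

/-- In the variable `v = -log u`, the dilogarithm along the ray is an antiderivative of
`log (1 - x e^{-v})`. -/
theorem hasDerivAt_dilog_exp_neg (hd : 0 < d)
    (hx : ∀ s ∈ Set.Icc (0 : ℝ) 1, d ≤ ‖1 - (s : ℂ) * x‖) {v : ℝ} (hv : 0 ≤ v) :
    HasDerivAt (fun v : ℝ => dilog ((Real.exp (-v) : ℝ) * x))
      (Complex.log (1 - (Real.exp (-v) : ℝ) * x)) v := by
  have h1 : HasDerivAt (fun v : ℝ => Real.exp (-v)) (-Real.exp (-v)) v := by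
    simpa using (hasDerivAt_neg v).exp
  have h2 := (hasDerivAt_dilog_ofReal_mul hd hx (Real.exp_pos (-v))
    (Real.exp_le_one_iff.2 (by linarith))).scomp v h1
  refine h2.congr_deriv ?_
  have : ((Real.exp (-v) : ℝ) : ℂ) ≠ 0 := by exact_mod_cast (Real.exp_pos _).ne'
  rw [Complex.real_smul, Complex.ofReal_neg]
  field_simp

theorem hasDerivAt_log_one_sub_exp_neg (hd : 0 < d)
    (hx : ∀ s ∈ Set.Icc (0 : ℝ) 1, d ≤ ‖1 - (s : ℂ) * x‖) {v : ℝ} (hv : 0 ≤ v) :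
    HasDerivAt (fun v : ℝ => Complex.log (1 - (Real.exp (-v) : ℝ) * x))
      ((Real.exp (-v) : ℝ) * x / (1 - (Real.exp (-v) : ℝ) * x)) v := by
  have h1 : HasDerivAt (fun v : ℝ => Real.exp (-v)) (-Real.exp (-v)) v := by
    simpa using (hasDerivAt_neg v).exp
  have h2 := (hasDerivAt_log_one_sub_mul (one_sub_mem_slitPlane hd hx
    ⟨(Real.exp_pos (-v)).le, Real.exp_le_one_iff.2 (by linarith)⟩)).scomp v h1
  refine h2.congr_deriv ?_
  rw [Complex.real_smul, Complex.ofReal_neg]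
  ring

theorem hasDerivAt_exp_neg_mul_div (hd : 0 < d)
    (hx : ∀ s ∈ Set.Icc (0 : ℝ) 1, d ≤ ‖1 - (s : ℂ) * x‖) {v : ℝ} (hv : 0 ≤ v) :
    HasDerivAt (fun v : ℝ => ((Real.exp (-v) : ℝ) : ℂ) * x / (1 - (Real.exp (-v) : ℝ) * x))
      (-((Real.exp (-v) : ℝ) * x) / (1 - (Real.exp (-v) : ℝ) * x) ^ 2) v := by
  have h0 : HasDerivAt (fun v : ℝ => Real.exp (-v)) (-Real.exp (-v)) v := by
    simpa using (hasDerivAt_neg v).exp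
  have h1 : HasDerivAt (fun v : ℝ => ((Real.exp (-v) : ℝ) : ℂ) * x)
      (-(Real.exp (-v) : ℝ) * x) v := by
    simpa using h0.ofReal_comp.mul_const x
  have hne : (1 - (Real.exp (-v) : ℝ) * x) ≠ 0 := Complex.slitPlane_ne_zero
    (one_sub_mem_slitPlane hd hx ⟨(Real.exp_pos (-v)).le, Real.exp_le_one_iff.2 (by linarith)⟩)
  convert h1.fun_div (h1.const_sub 1) hne using 1
  congr 1
  ring

end dilogarithm

/-- Error of the trapezoidal rule on `[a, a + h]`, for a function `f` with antiderivative `G` and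
second derivative `f''` bounded by `M`. The constant is not optimal. -/
theorem norm_trapezoid_error_le {G f f' f'' : ℝ → ℂ} {a h M : ℝ} (hh : 0 ≤ h)
    (hG : ∀ v ∈ Set.Icc a (a + h), HasDerivAt G (f v) v)
    (hf : ∀ v ∈ Set.Icc a (a + h), HasDerivAt f (f' v) v)
    (hf' : ∀ v ∈ Set.Icc a (a + h), HasDerivAt f' (f'' v) v)
    (hM : ∀ v ∈ Set.Icc a (a + h), ‖f'' v‖ ≤ M) :
    ‖G (a + h) - G a - h / 2 * (f a + f (a + h))‖ ≤ M * h ^ 3 := by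
  have ha : a ∈ Set.Icc a (a + h) := ⟨le_rfl, by linarith⟩
  have hb : a + h ∈ Set.Icc a (a + h) := ⟨by linarith, le_rfl⟩
  have hM0 : 0 ≤ M := (norm_nonneg _).trans (hM a ha)
  have hl : ∀ v : ℝ, HasDerivAt (fun w : ℝ => ((w - a : ℝ) : ℂ) / 2) (1 / 2) v := fun v => by
    simpa using (((hasDerivAt_id v).sub_const a).ofReal_comp).div_const (2 : ℂ)
  -- the derivative of the error, as a function of the right endpoint
  have h1 : ∀ v ∈ Set.Icc a (a + h),
      HasDerivAt (fun w => f w - 1 / 2 * (f a + f w) - ((w - a : ℝ) : ℂ) / 2 * f' w)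
        (-(((v - a : ℝ) : ℂ) / 2 * f'' v)) v := fun v hv => by
    refine (((hf v hv).fun_sub (((hf v hv).const_add (f a)).const_mul (1 / 2))).fun_sub
      ((hl v).fun_mul (hf' v hv))).congr_deriv ?_
    ring
  have h2 : ∀ v ∈ Set.Icc a (a + h),
      HasDerivAt (fun w => G w - G a - ((w - a : ℝ) : ℂ) / 2 * (f a + f w))
        (f v - 1 / 2 * (f a + f v) - ((v - a : ℝ) : ℂ) / 2 * f' v) v := fun v hv => by
    refine (((hG v hv).sub_const (G a)).fun_sub
      ((hl v).fun_mul ((hf v hv).const_add (f a)))).congr_deriv ?_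
    ring
  have h3 : ∀ v ∈ Set.Icc a (a + h), ‖-(((v - a : ℝ) : ℂ) / 2 * f'' v)‖ ≤ h * M := fun v hv => by
    rw [norm_neg, norm_mul, norm_div, Complex.norm_real, Real.norm_of_nonneg (by linarith [hv.1])]
    refine mul_le_mul ?_ (hM v hv) (norm_nonneg _) hh
    simp only [Complex.norm_ofNat]
    linarith [hv.2]
  have h4 : ∀ v ∈ Set.Icc a (a + h),
      ‖f v - 1 / 2 * (f a + f v) - ((v - a : ℝ) : ℂ) / 2 * f' v‖ ≤ h * M * h := fun v hv => by
    have := Convex.norm_image_sub_le_of_norm_hasDerivWithin_le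
      (fun w hw => (h1 w hw).hasDerivWithinAt) h3 (convex_Icc a (a + h)) ha hv
    rw [Real.norm_of_nonneg (by linarith [hv.1])] at this
    have h5 : h * M * (v - a) ≤ h * M * h := by gcongr; linarith [hv.2]
    refine le_trans (le_of_eq ?_) (this.trans h5)
    congr 1
    simp
    ring
  have := Convex.norm_image_sub_le_of_norm_hasDerivWithin_le
    (fun w hw => (h2 w hw).hasDerivWithinAt) h4 (convex_Icc a (a + h)) ha hb
  rw [Real.norm_of_nonneg (by linarith)] at this
  refine le_trans (le_of_eq ?_) (this.trans_eq (by ring))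
  congr 1
  simp

/-! ### Asymptotics of Euler's series -/

theorem one_div_one_sub_exp_neg_le {ε : ℝ} (hε0 : 0 < ε) (hε1 : ε ≤ 1) :
    1 / (1 - Real.exp (-ε)) ≤ 2 / ε := by
  have h1 : Real.exp (-ε) * (1 + ε) ≤ 1 := by
    calc _ ≤ Real.exp (-ε) * Real.exp ε := by gcongr; linarith [Real.add_one_le_exp ε]
      _ = 1 := by rw [← Real.exp_add]; simp
  have h2 : Real.exp (-ε) < 1 := Real.exp_lt_one_iff.2 (by linarith)
  rw [div_le_div_iff₀ (by linarith) hε0]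
  nlinarith

theorem exp_neg_pow (ε : ℝ) (n : ℕ) : Real.exp (-ε) ^ n = Real.exp (-(n * ε)) := by
  rw [← Real.exp_nat_mul]; ring_nf

theorem norm_exp_sub_one_le_exp_norm_sub_one (z : ℂ) :
    ‖Complex.exp z - 1‖ ≤ Real.exp ‖z‖ - 1 := by
  simpa using Complex.norm_exp_sub_sum_le_exp_norm_sub_sum z 1

theorem exp_sub_one_le_mul_exp (y : ℝ) : Real.exp y - 1 ≤ y * Real.exp y := by
  have h1 := Real.add_one_le_exp (-y)
  have h2 : Real.exp (-y) * Real.exp y = 1 := by rw [← Real.exp_add]; simp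
  nlinarith [Real.exp_pos y]

/-- Summation form of the trapezoidal rule. -/
theorem mul_sum_range_eq (c : ℂ) (g D : ℕ → ℂ) (M : ℕ) :
    c * ∑ n ∈ Finset.range M, g n = D M - D 0 + c / 2 * g 0 - c / 2 * g M -
      ∑ n ∈ Finset.range M, (D (n + 1) - D n - c / 2 * (g n + g (n + 1))) := by
  induction M with
  | zero => simp
  | succ M ih =>
    rw [Finset.sum_range_succ, Finset.sum_range_succ, mul_add, ih]
    ring

section uniform

variable {x : ℂ} {d ε : ℝ}

theorem norm_trapezoid_error_log_le (hd : 0 < d)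
    (hx : ∀ s ∈ Set.Icc (0 : ℝ) 1, d ≤ ‖1 - (s : ℂ) * x‖) (hε0 : 0 < ε) (n : ℕ) :
    ‖dilog ((Real.exp (-((n + 1 : ℕ) * ε)) : ℝ) * x) - dilog ((Real.exp (-(n * ε)) : ℝ) * x) -
      ε / 2 * (Complex.log (1 - (Real.exp (-(n * ε)) : ℝ) * x) +
        Complex.log (1 - (Real.exp (-((n + 1 : ℕ) * ε)) : ℝ) * x))‖ ≤
      ‖x‖ / d ^ 2 * Real.exp (-ε) ^ n * ε ^ 3 := by
  have hn : (0 : ℝ) ≤ n * ε := by positivity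
  have h := norm_trapezoid_error_le (a := n * ε) (h := ε)
    (M := ‖x‖ / d ^ 2 * Real.exp (-ε) ^ n) hε0.le
    (fun v hv => hasDerivAt_dilog_exp_neg hd hx (hn.trans hv.1))
    (fun v hv => hasDerivAt_log_one_sub_exp_neg hd hx (hn.trans hv.1))
    (fun v hv => hasDerivAt_exp_neg_mul_div hd hx (hn.trans hv.1))
    (fun v hv => by
      have hv0 : 0 ≤ v := hn.trans hv.1
      have h1 := hx (Real.exp (-v))
        ⟨(Real.exp_pos _).le, Real.exp_le_one_iff.2 (by linarith)⟩
      have h2 : Real.exp (-v) ≤ Real.exp (-ε) ^ n := by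
        rw [exp_neg_pow]; exact Real.exp_le_exp.2 (by linarith [hv.1])
      rw [norm_div, norm_neg, norm_mul, norm_pow, Complex.norm_real,
        Real.norm_of_nonneg (Real.exp_pos _).le, div_mul_eq_mul_div, mul_comm]
      gcongr)
  have he : ((n + 1 : ℕ) : ℝ) * ε = n * ε + ε := by push_cast; ring
  rw [he]
  exact h

/-- `eulerSeries q x = exp (-Li₂(x)/ε + log(1-x)/2 + O(ε))` for `q = e^{-ε}`, with an explicit
error that depends on `x` only through its norm and a lower bound `d` for `|1 - s x|` on
`0 ≤ s ≤ 1`. The trapezoidal rule with step `ε` is applied to `log (1 - x e^{-v})` on `[0, M ε]`,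
and then `M → ∞`. -/
theorem norm_eulerSeries_mul_exp_sub_one_le (hd : 0 < d)
    (hx : ∀ s ∈ Set.Icc (0 : ℝ) 1, d ≤ ‖1 - (s : ℂ) * x‖) (hε0 : 0 < ε) (hε1 : ε ≤ 1) :
    ‖eulerSeries (Real.exp (-ε)) x *
        Complex.exp (-(-(1 / (ε : ℂ)) * dilog x + 1 / 2 * Complex.log (1 - x))) - 1‖ ≤
      Real.exp (2 * ‖x‖ / d ^ 2 * ε) - 1 := by
  set q := Real.exp (-ε) with hq
  have hq0 : 0 < q := Real.exp_pos _
  have hq1 : q < 1 := Real.exp_lt_one_iff.2 (by linarith)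
  have hεC : (ε : ℂ) ≠ 0 := by exact_mod_cast hε0.ne'
  set g : ℕ → ℂ := fun n => Complex.log (1 - (Real.exp (-(n * ε)) : ℝ) * x) with hg
  set D : ℕ → ℂ := fun n => dilog ((Real.exp (-(n * ε)) : ℝ) * x) with hD
  set e : ℕ → ℂ := fun n => D (n + 1) - D n - ε / 2 * (g n + g (n + 1)) with he
  set δ : ℕ → ℂ := fun M => D M / ε - g M / 2 - (∑ n ∈ Finset.range M, e n) / ε with hδ
  have hmem : ∀ n : ℕ, Real.exp (-(n * ε)) ∈ Set.Icc (0 : ℝ) 1 := fun n =>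
    ⟨(Real.exp_pos _).le, Real.exp_le_one_iff.2 (neg_nonpos.2 (by positivity))⟩
  have hprod : ∀ M : ℕ, ∏ n ∈ Finset.range M, (1 - x * (q : ℂ) ^ n) =
      Complex.exp (-(1 / (ε : ℂ)) * dilog x + 1 / 2 * Complex.log (1 - x)) *
        Complex.exp (δ M) := by
    intro M
    have h1 : ∀ n, 1 - x * (q : ℂ) ^ n = Complex.exp (g n) := fun n => by
      rw [hg, Complex.exp_log (Complex.slitPlane_ne_zero (one_sub_mem_slitPlane hd hx (hmem n))),
        ← exp_neg_pow, hq, Complex.ofReal_pow, mul_comm]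
    simp_rw [h1]
    rw [← Complex.exp_sum, ← Complex.exp_add]
    congr 1
    have h2 := mul_sum_range_eq (ε : ℂ) g D M
    have h3 : ∑ n ∈ Finset.range M, g n = (ε : ℂ)⁻¹ * (D M - D 0 + ε / 2 * g 0 - ε / 2 * g M -
        ∑ n ∈ Finset.range M, e n) := by
      rw [← h2]; field_simp
    have hD0 : D 0 = dilog x := by simp [hD]
    have hg0 : g 0 = Complex.log (1 - x) := by simp [hg]
    rw [h3, hD0, hg0]
    simp only [hδ]
    field_simp
    ring
  have hδle : ∀ M : ℕ, ‖δ M‖ ≤ ‖x‖ / d * q ^ M * (1 / ε + 1 / 2) + 2 * ‖x‖ / d ^ 2 * ε := by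
    intro M
    have h1 : ‖D M / ε‖ ≤ ‖x‖ / d * q ^ M * (1 / ε) := by
      rw [norm_div, Complex.norm_real, Real.norm_of_nonneg hε0.le, div_eq_mul_one_div, hq,
        exp_neg_pow]
      gcongr
      exact norm_dilog_ofReal_mul_le hd hx (Real.exp_pos _) (hmem M).2
    have h2 : ‖g M / 2‖ ≤ ‖x‖ / d * q ^ M * (1 / 2) := by
      rw [norm_div, Complex.norm_ofNat, div_eq_mul_one_div, hq, exp_neg_pow]
      gcongr
      exact norm_log_one_sub_mul_le hd hx (hmem M)
    have h3 : ‖(∑ n ∈ Finset.range M, e n) / ε‖ ≤ 2 * ‖x‖ / d ^ 2 * ε := by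
      rw [norm_div, Complex.norm_real, Real.norm_of_nonneg hε0.le, div_le_iff₀ hε0]
      calc _ ≤ ∑ n ∈ Finset.range M, ‖x‖ / d ^ 2 * q ^ n * ε ^ 3 :=
            (norm_sum_le _ _).trans (Finset.sum_le_sum fun n _ =>
              norm_trapezoid_error_log_le hd hx hε0 n)
        _ = ‖x‖ / d ^ 2 * ε ^ 3 * ∑ n ∈ Finset.range M, q ^ n := by
            rw [Finset.mul_sum]; exact Finset.sum_congr rfl fun n _ => by ring
        _ ≤ ‖x‖ / d ^ 2 * ε ^ 3 * (2 / ε) := by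
            gcongr
            refine le_trans ?_ (one_div_one_sub_exp_neg_le hε0 hε1)
            have hs := geom_sum_mul_neg q M
            rw [le_div_iff₀ (by linarith), hs]
            linarith [pow_pos hq0 M]
        _ = _ := by field_simp
    calc ‖δ M‖ ≤ ‖D M / ε‖ + ‖g M / 2‖ + ‖(∑ n ∈ Finset.range M, e n) / ε‖ :=
          (norm_sub_le _ _).trans (by gcongr; exact norm_sub_le _ _)
      _ ≤ _ := by linarith
  have hbound : ∀ M : ℕ, ‖eulerSeries q x *
      Complex.exp (-(-(1 / (ε : ℂ)) * dilog x + 1 / 2 * Complex.log (1 - x))) - 1‖ ≤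
      Real.exp (‖x‖ / d * q ^ M * (1 / ε + 1 / 2) + 2 * ‖x‖ / d ^ 2 * ε) *
        ‖eulerSeries q (x * q ^ M) - 1‖ +
      (Real.exp (‖x‖ / d * q ^ M * (1 / ε + 1 / 2) + 2 * ‖x‖ / d ^ 2 * ε) - 1) := by
    intro M
    have h1 : eulerSeries q x *
        Complex.exp (-(-(1 / (ε : ℂ)) * dilog x + 1 / 2 * Complex.log (1 - x))) - 1 =
        Complex.exp (δ M) * (eulerSeries q (x * q ^ M) - 1) + (Complex.exp (δ M) - 1) := by
      rw [eulerSeries_eq_prod_mul hq0 hq1 x M, hprod M, Complex.exp_neg]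
      have := Complex.exp_ne_zero (-(1 / (ε : ℂ)) * dilog x + 1 / 2 * Complex.log (1 - x))
      field_simp
      ring
    rw [h1]
    refine (norm_add_le _ _).trans (add_le_add ?_ ?_)
    · rw [norm_mul]
      gcongr
      exact (Complex.norm_exp_le_exp_norm _).trans (Real.exp_le_exp.2 (hδle M))
    · refine (norm_exp_sub_one_le_exp_norm_sub_one _).trans ?_
      gcongr
      exact hδle M
  refine ge_of_tendsto' (x := atTop) ?_ hbound
  have ht1 : Tendsto (fun M : ℕ =>
      Real.exp (‖x‖ / d * q ^ M * (1 / ε + 1 / 2) + 2 * ‖x‖ / d ^ 2 * ε)) atTop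
      (𝓝 (Real.exp (‖x‖ / d * 0 * (1 / ε + 1 / 2) + 2 * ‖x‖ / d ^ 2 * ε))) :=
    ((((tendsto_pow_atTop_nhds_zero_of_lt_one hq0.le hq1).const_mul _).mul_const _).add_const
      _).rexp
  have ht2 := tendsto_iff_norm_sub_tendsto_zero.1 (tendsto_eulerSeries_mul_pow hq0 hq1 x)
  simpa using (ht1.mul ht2).add (ht1.sub_const 1)

/-! ### The finite Taylor sum -/

theorem exp_sub_one_le_two_mul {y : ℝ} (hy0 : 0 ≤ y) (hy1 : y ≤ 1) :
    Real.exp y - 1 ≤ 2 * y := by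
  have := Real.abs_exp_sub_one_le (x := y) (by rwa [abs_of_nonneg hy0])
  rw [abs_of_nonneg hy0] at this
  exact (le_abs_self _).trans this

theorem exp_neg_pow_inv_bounds (hε0 : 0 < ε) {n : ℕ} (hn : n * ε ≤ 1) :
    ‖((Real.exp (-ε) : ℂ) ^ n)⁻¹‖ ≤ 3 ∧ ‖((Real.exp (-ε) : ℂ) ^ n)⁻¹ - 1‖ ≤ 2 * (n * ε) := by
  have h0 : 0 ≤ n * ε := by positivity
  have h1 : ((Real.exp (-ε) : ℂ) ^ n)⁻¹ = (Real.exp (n * ε) : ℝ) := by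
    rw [← Complex.ofReal_pow, exp_neg_pow, ← Complex.ofReal_inv, ← Real.exp_neg, neg_neg]
  have h2 := exp_sub_one_le_two_mul h0 hn
  rw [h1]
  constructor
  · rw [Complex.norm_real, Real.norm_of_nonneg (Real.exp_pos _).le]
    linarith
  · rw [← Complex.ofReal_one, ← Complex.ofReal_sub, Complex.norm_real,
      Real.norm_of_nonneg (by linarith [Real.one_le_exp h0])]
    exact h2

variable {R : ℝ}

theorem norm_prod_one_sub_le (hR : ‖x‖ ≤ R) (hε0 : 0 < ε) {n : ℕ} (hn : n * ε ≤ 1) :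
    ‖∏ j ∈ Finset.range n, (1 - x * ((Real.exp (-ε) : ℂ) ^ (j + 1))⁻¹)‖ ≤ (1 + 3 * R) ^ n := by
  rw [norm_prod]
  refine (Finset.prod_le_prod (g := fun _ => 1 + 3 * R) (fun j _ => norm_nonneg _)
    fun j hj => ?_).trans_eq (by simp)
  have hj' : ((j + 1 : ℕ) : ℝ) * ε ≤ 1 := le_trans (by gcongr; simpa using hj) hn
  have := (exp_neg_pow_inv_bounds hε0 hj').1
  refine (norm_sub_le _ _).trans ?_
  rw [norm_one, norm_mul, mul_comm 3]
  gcongr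
  exact (norm_nonneg _).trans hR

theorem norm_prod_one_sub_sub_pow_le (hR : ‖x‖ ≤ R) (hε0 : 0 < ε) {n : ℕ} (hn : n * ε ≤ 1) :
    ‖∏ j ∈ Finset.range n, (1 - x * ((Real.exp (-ε) : ℂ) ^ (j + 1))⁻¹) - (1 - x) ^ n‖ ≤
      (1 + 3 * R) ^ n * (2 * R * ε * n ^ 2) := by
  have hR0 : 0 ≤ R := (norm_nonneg _).trans hR
  induction n with
  | zero => simp
  | succ n ih =>
    have hn' : (n : ℝ) * ε ≤ 1 := le_trans (by gcongr; simp) hn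
    obtain ⟨h1, h2⟩ := exp_neg_pow_inv_bounds hε0 hn
    specialize ih hn'
    rw [Finset.prod_range_succ]
    set p := ∏ j ∈ Finset.range n, (1 - x * ((Real.exp (-ε) : ℂ) ^ (j + 1))⁻¹)
    set w := ((Real.exp (-ε) : ℂ) ^ (n + 1))⁻¹
    have e : p * (1 - x * w) - (1 - x) ^ (n + 1) =
        (p - (1 - x) ^ n) * (1 - x * w) - (1 - x) ^ n * (x * (w - 1)) := by ring
    have h3 : ‖1 - x * w‖ ≤ 1 + 3 * R := by
      refine (norm_sub_le _ _).trans ?_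
      rw [norm_one, norm_mul, mul_comm 3]
      gcongr
    have h4 : ‖(1 - x) ^ n‖ ≤ (1 + 3 * R) ^ (n + 1) := by
      rw [norm_pow]
      calc ‖1 - x‖ ^ n ≤ (1 + 3 * R) ^ n := by
            gcongr
            refine (norm_sub_le _ _).trans ?_
            rw [norm_one]; linarith
        _ ≤ _ := pow_le_pow_right₀ (by linarith) (Nat.le_succ n)
    rw [e]
    refine (norm_sub_le _ _).trans ?_
    rw [norm_mul, norm_mul, norm_mul x]
    calc _ ≤ (1 + 3 * R) ^ n * (2 * R * ε * n ^ 2) * (1 + 3 * R) +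
          (1 + 3 * R) ^ (n + 1) * (R * (2 * ((n + 1 : ℕ) * ε))) := by gcongr
      _ = (1 + 3 * R) ^ (n + 1) * (2 * R * ε * (n ^ 2 + n + 1)) := by push_cast; ring
      _ ≤ _ := by
        gcongr
        push_cast
        nlinarith [(Nat.cast_nonneg n : (0 : ℝ) ≤ n)]

theorem norm_sum_prod_le {t : ℝ} (ht : 0 ≤ t) (hR : ‖x‖ ≤ R) (hε0 : 0 < ε) {N : ℕ}
    (hN : N * ε ≤ 1) :
    ‖∑ n ∈ Finset.range N, (-(t : ℂ)) ^ n / n.factorial *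
      ∏ j ∈ Finset.range n, (1 - x * ((Real.exp (-ε) : ℂ) ^ (j + 1))⁻¹)‖ ≤
      Real.exp (t * (1 + 3 * R)) := by
  have hR0 : 0 ≤ R := (norm_nonneg _).trans hR
  refine (norm_sum_le _ _).trans (le_trans (Finset.sum_le_sum fun n hn => ?_)
    (Real.sum_le_exp_of_nonneg (by positivity : 0 ≤ t * (1 + 3 * R)) N))
  have hn' : (n : ℝ) * ε ≤ 1 := le_trans (by gcongr; exact (Finset.mem_range.1 hn).le) hN
  rw [norm_mul, norm_div, norm_pow, norm_neg, Complex.norm_real, Real.norm_of_nonneg ht,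
    Complex.norm_natCast, mul_pow, mul_div_right_comm]
  gcongr
  exact norm_prod_one_sub_le hR hε0 hn'

theorem norm_sum_prod_sub_exp_le {t : ℝ} (ht : 0 ≤ t) (hR : ‖x‖ ≤ R) (hε0 : 0 < ε) {N : ℕ}
    (hN : N * ε ≤ 1) (hN' : 1 / ε ≤ N + 1) :
    ‖∑ n ∈ Finset.range N, (-(t : ℂ)) ^ n / n.factorial *
      ∏ j ∈ Finset.range n, (1 - x * ((Real.exp (-ε) : ℂ) ^ (j + 1))⁻¹) -
        Complex.exp (-(t * (1 - x)))‖ ≤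
      (2 * R * Real.exp (4 * (t * (1 + 3 * R))) + Real.exp (2 * (t * (1 + 3 * R)))) * ε := by
  have hR0 : 0 ≤ R := (norm_nonneg _).trans hR
  have h1 : ‖∑ n ∈ Finset.range N, (-(t : ℂ)) ^ n / n.factorial *
      ∏ j ∈ Finset.range n, (1 - x * ((Real.exp (-ε) : ℂ) ^ (j + 1))⁻¹) -
      ∑ n ∈ Finset.range N, (-(t * (1 - x))) ^ n / (n.factorial : ℂ)‖ ≤
      2 * R * Real.exp (4 * (t * (1 + 3 * R))) * ε := by
    rw [← Finset.sum_sub_distrib]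
    calc _ ≤ ∑ n ∈ Finset.range N,
          2 * R * ε * ((4 * (t * (1 + 3 * R))) ^ n / (n.factorial : ℝ)) := by
          refine (norm_sum_le _ _).trans (Finset.sum_le_sum fun n hn => ?_)
          have hn' : (n : ℝ) * ε ≤ 1 :=
            le_trans (by gcongr; exact (Finset.mem_range.1 hn).le) hN
          rw [← neg_mul, mul_pow, mul_div_right_comm, ← mul_sub, norm_mul, norm_div, norm_pow,
            norm_neg, Complex.norm_real, Real.norm_of_nonneg ht, Complex.norm_natCast]
          have h4 : (n : ℝ) ^ 2 ≤ 4 ^ n := by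
            have : (n : ℝ) ≤ 2 ^ n := by exact_mod_cast (Nat.lt_two_pow_self (n := n)).le
            calc (n : ℝ) ^ 2 ≤ (2 ^ n) ^ 2 := by gcongr
              _ = 4 ^ n := by rw [← pow_mul, mul_comm, pow_mul]; norm_num
          calc _ ≤ t ^ n / n.factorial * ((1 + 3 * R) ^ n * (2 * R * ε * 4 ^ n)) := by
                gcongr
                refine (norm_prod_one_sub_sub_pow_le hR hε0 hn').trans ?_
                gcongr
            _ = _ := by rw [mul_pow, mul_pow]; ring
      _ = 2 * R * ε * ∑ n ∈ Finset.range N, (4 * (t * (1 + 3 * R))) ^ n / (n.factorial : ℝ) := by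
          rw [Finset.mul_sum]
      _ ≤ 2 * R * ε * Real.exp (4 * (t * (1 + 3 * R))) := by
          gcongr
          exact Real.sum_le_exp_of_nonneg (by positivity) N
      _ = _ := by ring
  have h2 : ‖∑ n ∈ Finset.range N, (-(t * (1 - x))) ^ n / (n.factorial : ℂ) -
      Complex.exp (-(t * (1 - x)))‖ ≤ Real.exp (2 * (t * (1 + 3 * R))) * ε := by
    rw [norm_sub_rev]
    have hb : ‖-(t * (1 - x))‖ ≤ t * (1 + 3 * R) := by
      rw [norm_neg, norm_mul, Complex.norm_real, Real.norm_of_nonneg ht]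
      gcongr
      refine (norm_sub_le _ _).trans ?_
      rw [norm_one]; linarith
    refine ((Complex.norm_exp_sub_sum_le_exp_norm_sub_sum _ N).trans
      (exp_sub_sum_range_le (norm_nonneg _) N)).trans ?_
    rw [div_eq_mul_one_div]
    gcongr
    exact one_div_two_pow_le hε0 hN'
  calc _ ≤ _ := norm_sub_le_norm_sub_add_norm_sub _ _ _
    _ ≤ _ := add_le_add h1 h2
    _ = _ := by ring

/-- The Taylor remainder beats every factor `exp (c / ε)` when `N ~ 1 / ε` terms are taken. -/
theorem pow_div_factorial_mul_exp_le {t c : ℝ} (ht : 0 ≤ t) (hc : 0 ≤ c) (hε0 : 0 < ε) {N : ℕ}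
    (hN' : 1 / ε ≤ N + 1) :
    t ^ N / N.factorial * Real.exp (c / ε) ≤
      Real.exp c * Real.exp (2 * (t * Real.exp c)) * ε := by
  have h1 : c / ε ≤ c + N * c := by
    calc c / ε = c * (1 / ε) := by ring
      _ ≤ c * (N + 1) := by gcongr
      _ = _ := by ring
  calc _ ≤ t ^ N / N.factorial * Real.exp (c + N * c) := by gcongr
    _ = Real.exp c * ((t * Real.exp c) ^ N / N.factorial) := by
        rw [Real.exp_add, Real.exp_nat_mul, mul_pow]; ring
    _ ≤ Real.exp c * (Real.exp (2 * (t * Real.exp c)) * (1 / 2 ^ N)) := by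
        gcongr
        rw [← div_eq_mul_one_div]
        exact pow_div_factorial_le_exp_div (by positivity) N
    _ ≤ Real.exp c * (Real.exp (2 * (t * Real.exp c)) * ε) := by
        gcongr
        exact one_div_two_pow_le hε0 hN'
    _ = _ := by ring

theorem norm_exp_neg_mainExponent_le {t : ℝ} (ht : 0 ≤ t) (hd : 0 < d) (hR : ‖x‖ ≤ R)
    (hx : ∀ s ∈ Set.Icc (0 : ℝ) 1, d ≤ ‖1 - (s : ℂ) * x‖) (hε0 : 0 < ε) :
    ‖Complex.exp (-mainExponent x t ε)‖ ≤ Real.exp (R / d / 2 + t * R) * Real.exp (R / d / ε) := by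
  have h1 : ‖dilog x‖ ≤ R / d := by
    have := norm_dilog_ofReal_mul_le hd hx one_pos le_rfl
    simp only [Complex.ofReal_one, one_mul, mul_one] at this
    exact this.trans (by gcongr)
  have h2 : ‖Complex.log (1 - x)‖ ≤ R / d := by
    have := norm_log_one_sub_mul_le hd hx (s := 1) ⟨zero_le_one, le_rfl⟩
    simp only [Complex.ofReal_one, one_mul, mul_one] at this
    exact this.trans (by gcongr)
  refine (Complex.norm_exp_le_exp_norm _).trans ?_
  rw [← Real.exp_add, Real.exp_le_exp, norm_neg, mainExponent]
  refine (norm_add_le _ _).trans ?_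
  have h3 : ‖-(1 / (ε : ℂ)) * dilog x‖ ≤ R / d / ε := by
    rw [norm_mul, norm_neg, norm_div, norm_one, Complex.norm_real, Real.norm_of_nonneg hε0.le,
      div_mul_eq_mul_div, one_mul]
    gcongr
  have h4 : ‖(1 / 2 : ℂ) * Complex.log (1 - x)‖ ≤ R / d / 2 := by
    rw [norm_mul, norm_div, norm_one, Complex.norm_ofNat]
    linarith
  have h5 : ‖(t : ℂ) * x‖ ≤ t * R := by
    rw [norm_mul, Complex.norm_real, Real.norm_of_nonneg ht]
    gcongr
  have := norm_add_le (-(1 / (ε : ℂ)) * dilog x) ((1 / 2 : ℂ) * Complex.log (1 - x))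
  linarith

/-- The asymptotic formula as a relative error, uniform over bounded `x` for which the segment
from `1` to `1 - x` stays at distance at least `d` from `0`. -/
theorem exists_norm_qF_mul_exp_sub_one_le {t : ℝ} (ht : 0 ≤ t) (R : ℝ) (hd : 0 < d) :
    ∃ C : ℝ, ∀ x : ℂ, ‖x‖ ≤ R → (∀ s ∈ Set.Icc (0 : ℝ) 1, d ≤ ‖1 - (s : ℂ) * x‖) →
      ∀ ε : ℝ, 0 < ε → ε ≤ 1 →
        ‖qF x t (Real.exp (-ε)) * Complex.exp (-mainExponent x t ε) - 1‖ ≤ C * ε := by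
  set K := 2 * R / d ^ 2 with hK
  set c := 6 * R + R / d with hc
  refine ⟨Real.exp t * Real.exp (R / d / 2 + t * R) *
      (Real.exp c * Real.exp (2 * (t * Real.exp c))) + Real.exp t * Real.exp (t * R) *
    (K * Real.exp K * Real.exp (t * (1 + 3 * R)) +
      (2 * R * Real.exp (4 * (t * (1 + 3 * R))) + Real.exp (2 * (t * (1 + 3 * R))))),
    fun x hR hx ε hε0 hε1 => ?_⟩
  have hR0 : 0 ≤ R := (norm_nonneg _).trans hR
  set q := Real.exp (-ε) with hq
  have hq0 : 0 < q := Real.exp_pos _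
  have hq1 : q < 1 := Real.exp_lt_one_iff.2 (by linarith)
  -- The order of the expansion: `N ε ≤ 1` keeps `q^{-N}` bounded, while `1 / N!` beats `exp (c/ε)`.
  set N := ⌊1 / ε⌋₊
  have hN : N * ε ≤ 1 := by
    rw [← le_div_iff₀ hε0]; exact Nat.floor_le (by positivity)
  have hN' : 1 / ε ≤ N + 1 := (Nat.lt_floor_add_one _).le
  set S := ∑ n ∈ Finset.range N, (-(t : ℂ)) ^ n / n.factorial *
    ∏ j ∈ Finset.range n, (1 - x * ((q : ℂ) ^ (j + 1))⁻¹) with hS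
  set p := eulerSeries q x *
    Complex.exp (-(-(1 / (ε : ℂ)) * dilog x + 1 / 2 * Complex.log (1 - x))) with hp
  have hdecomp : qF x t q * Complex.exp (-mainExponent x t ε) - 1 =
      (qF x t q - Complex.exp t * (eulerSeries q x * S)) * Complex.exp (-mainExponent x t ε) +
      Complex.exp t * Complex.exp (-(t * x)) *
        ((p - 1) * S + (S - Complex.exp (-(t * (1 - x))))) := by
    have h1 : Complex.exp (-mainExponent x t ε) = Complex.exp (-(t * x)) *
        Complex.exp (-(-(1 / (ε : ℂ)) * dilog x + 1 / 2 * Complex.log (1 - x))) := by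
      rw [← Complex.exp_add, mainExponent]; ring_nf
    have h2 : Complex.exp t * Complex.exp (-(t * x)) * Complex.exp (-(t * (1 - x))) = 1 := by
      rw [← Complex.exp_add, ← Complex.exp_add,
        show (t : ℂ) + -(t * x) + -(t * (1 - x)) = 0 by ring, Complex.exp_zero]
    rw [h1, hp]
    linear_combination h2
  have hrem : ‖(qF x t q - Complex.exp t * (eulerSeries q x * S)) *
      Complex.exp (-mainExponent x t ε)‖ ≤ Real.exp t * Real.exp (R / d / 2 + t * R) *
        (Real.exp c * Real.exp (2 * (t * Real.exp c))) * ε := by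
    have h1 := norm_qF_sub_le hq0 hq1 ht x N
    have h2 : ‖x‖ * (q ^ N)⁻¹ / (1 - q) ≤ 6 * R / ε := by
      have h3 : (q ^ N)⁻¹ ≤ 3 := by
        have := (exp_neg_pow_inv_bounds hε0 hN).1
        rwa [← Complex.ofReal_pow, ← Complex.ofReal_inv, Complex.norm_real,
          Real.norm_of_nonneg (by positivity)] at this
      calc _ = ‖x‖ * (q ^ N)⁻¹ * (1 / (1 - q)) := by ring
        _ ≤ R * 3 * (2 / ε) := by
          have h4 : 0 ≤ 1 / (1 - q) := one_div_nonneg.2 (by linarith)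
          exact mul_le_mul (by gcongr) (one_div_one_sub_exp_neg_le hε0 hε1) h4 (by positivity)
        _ = _ := by ring
    have h3 := norm_exp_neg_mainExponent_le ht hd hR hx hε0
    have h4 := pow_div_factorial_mul_exp_le ht (by positivity : 0 ≤ c) hε0 hN'
    rw [norm_mul]
    calc _ ≤ Real.exp t * (t ^ N / N.factorial * Real.exp (6 * R / ε)) *
          (Real.exp (R / d / 2 + t * R) * Real.exp (R / d / ε)) := by
          gcongr
          refine h1.trans ?_
          gcongr
      _ = Real.exp t * Real.exp (R / d / 2 + t * R) *
          (t ^ N / N.factorial * Real.exp (c / ε)) := by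
          rw [hc, add_div, Real.exp_add (6 * R / ε)]; ring
      _ ≤ Real.exp t * Real.exp (R / d / 2 + t * R) *
          (Real.exp c * Real.exp (2 * (t * Real.exp c)) * ε) := by gcongr
      _ = _ := by ring
  have hpb : ‖p - 1‖ ≤ K * Real.exp K * ε := by
    have h1 : 2 * ‖x‖ / d ^ 2 * ε ≤ K * ε := by rw [hK]; gcongr
    have hK0 : 0 ≤ K := by positivity
    calc _ ≤ Real.exp (2 * ‖x‖ / d ^ 2 * ε) - 1 :=
          norm_eulerSeries_mul_exp_sub_one_le hd hx hε0 hε1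
      _ ≤ Real.exp (K * ε) - 1 := by gcongr
      _ ≤ K * ε * Real.exp (K * ε) := exp_sub_one_le_mul_exp _
      _ ≤ K * ε * Real.exp K := by gcongr; exact mul_le_of_le_one_right hK0 hε1
      _ = _ := by ring
  have hSb := norm_sum_prod_le ht hR hε0 hN
  have hSe := norm_sum_prod_sub_exp_le ht hR hε0 hN hN'
  have hA : ‖Complex.exp t * Complex.exp (-(t * x))‖ ≤ Real.exp t * Real.exp (t * R) := by
    rw [norm_mul, Complex.norm_exp_ofReal]
    gcongr
    refine (Complex.norm_exp_le_exp_norm _).trans (Real.exp_le_exp.2 ?_)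
    rw [norm_neg, norm_mul, Complex.norm_real, Real.norm_of_nonneg ht]
    gcongr
  rw [hdecomp, add_mul]
  refine (norm_add_le _ _).trans (add_le_add hrem ?_)
  rw [norm_mul]
  calc _ ≤ Real.exp t * Real.exp (t * R) *
        (K * Real.exp K * ε * Real.exp (t * (1 + 3 * R)) +
          (2 * R * Real.exp (4 * (t * (1 + 3 * R))) + Real.exp (2 * (t * (1 + 3 * R)))) * ε) := by
        gcongr
        refine (norm_add_le _ _).trans (add_le_add ?_ hSe)
        rw [norm_mul]
        gcongr
    _ = _ := by ring

end uniform

/-! ### From relative error to exponent -/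

/-- If `F = exp m * (1 + O(g))` with `g → 0`, then `F = exp (m + O(g))`. -/
theorem exists_isBigO_eq_exp_add {α : Type*} {l : Filter α} {F m : α → ℂ} {g : α → ℝ} {C : ℝ}
    (hg : Tendsto g l (𝓝 0)) (hg0 : ∀ᶠ a in l, 0 ≤ g a)
    (h : ∀ᶠ a in l, ‖F a * Complex.exp (-m a) - 1‖ ≤ C * g a) :
    ∃ E : α → ℂ, E =O[l] g ∧ ∀ᶠ a in l, F a = Complex.exp (m a + E a) := by
  have hsmall : ∀ᶠ a in l, ‖F a * Complex.exp (-m a) - 1‖ ≤ 1 / 2 := by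
    have h1 : Tendsto (fun a => C * g a) l (𝓝 0) := by simpa using hg.const_mul C
    filter_upwards [h, h1.eventually_le_const (by norm_num : (0 : ℝ) < 1 / 2)] with a h2 h3
    exact h2.trans h3
  refine ⟨fun a => Complex.log (F a * Complex.exp (-m a)), ?_, ?_⟩
  · refine IsBigO.of_bound (3 / 2 * C) ?_
    filter_upwards [h, hsmall, hg0] with a h1 h2 h3
    have := Complex.norm_log_one_add_half_le_self h2
    rw [add_sub_cancel] at this
    rw [Real.norm_of_nonneg h3]
    linarith
  · filter_upwards [hsmall] with a h2
    have hne : F a * Complex.exp (-m a) ≠ 0 := by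
      intro h0
      rw [h0] at h2
      norm_num at h2
    rw [Complex.exp_add, Complex.exp_log hne, Complex.exp_neg]
    field_simp [Complex.exp_ne_zero]

/-- Off the cut `[1, ∞)`, the segment from `1` to `1 - x` keeps a positive distance from `0`. -/
theorem exists_pos_le_norm_one_sub_mul {x : ℂ} (hx : x ∉ Complex.ofReal '' Set.Ici 1) :
    ∃ d > 0, ∀ s ∈ Set.Icc (0 : ℝ) 1, d ≤ ‖1 - (s : ℂ) * x‖ := by
  obtain ⟨s₀, hs₀, hmin⟩ := (isCompact_Icc (a := (0 : ℝ)) (b := 1)).exists_isMinOn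
    ⟨0, by simp⟩ (f := fun s : ℝ => ‖1 - (s : ℂ) * x‖) (by fun_prop)
  refine ⟨‖1 - (s₀ : ℂ) * x‖, norm_pos_iff.2 fun h => hx ?_, fun s hs => hmin hs⟩
  have h1 : (s₀ : ℂ) * x = 1 := (sub_eq_zero.1 h).symm
  have h0 : s₀ ≠ 0 := by rintro rfl; simp at h1
  refine ⟨s₀⁻¹, one_le_inv_iff₀.2 ⟨lt_of_le_of_ne hs₀.1 h0.symm, hs₀.2⟩, ?_⟩
  rw [Complex.ofReal_inv]
  exact inv_eq_of_mul_eq_one_right h1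

end

theorem theorem4p4 (t : ℝ) (ht : 0 ≤ t) :
    (∀ x : ℂ, x ∉ Complex.ofReal '' (Set.Iic 0 ∪ Set.Ici 1) →
      ∃ E : ℝ → ℂ, E =O[𝓝[>] (0 : ℝ)] (fun ε : ℝ => ε) ∧
        ∀ᶠ ε : ℝ in 𝓝[>] (0 : ℝ),
          qF x t (Real.exp (-ε)) = Complex.exp (mainExponent x t ε + E ε)) ∧
    (∀ φ : ℝ, -Real.pi < φ → φ < Real.pi →
      ∃ E : ℂ × ℝ → ℂ,
        E =O[zeroAtAngle φ ×ˢ 𝓝[>] (0 : ℝ)] (fun p : ℂ × ℝ => p.2) ∧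
        ∀ᶠ p : ℂ × ℝ in zeroAtAngle φ ×ˢ 𝓝[>] (0 : ℝ),
          qF p.1 t (Real.exp (-p.2)) = Complex.exp (mainExponent p.1 t p.2 + E p)) := by
  have hid : Tendsto (fun ε : ℝ => ε) (𝓝[>] 0) (𝓝 0) := tendsto_id'.2 nhdsWithin_le_nhds
  have hε : ∀ᶠ ε : ℝ in 𝓝[>] (0 : ℝ), 0 < ε ∧ ε ≤ 1 := by
    filter_upwards [Ioc_mem_nhdsGT one_pos] with ε h using h
  constructor
  · intro x hx
    obtain ⟨d, hd, hxd⟩ := exists_pos_le_norm_one_sub_mul (x := x)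
      fun h => hx (Set.image_mono Set.subset_union_right h)
    obtain ⟨C, hC⟩ := exists_norm_qF_mul_exp_sub_one_le ht ‖x‖ hd
    refine exists_isBigO_eq_exp_add hid (hε.mono fun ε h => h.1.le)
      (hε.mono fun ε h => hC x le_rfl hxd ε h.1 h.2)
  · intro φ _ _
    obtain ⟨C, hC⟩ := exists_norm_qF_mul_exp_sub_one_le ht (1 / 2) (d := 1 / 2) (by norm_num)
    have hε' : ∀ᶠ p : ℂ × ℝ in zeroAtAngle φ ×ˢ 𝓝[>] (0 : ℝ), 0 < p.2 ∧ p.2 ≤ 1 :=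
      tendsto_snd.eventually hε
    have hx' : ∀ᶠ p : ℂ × ℝ in zeroAtAngle φ ×ˢ 𝓝[>] (0 : ℝ), ‖p.1‖ ≤ 1 / 2 := by
      have h : Tendsto (fun p : ℂ × ℝ => ‖p.1‖) (zeroAtAngle φ ×ˢ 𝓝[>] (0 : ℝ)) (𝓝 ‖(0 : ℂ)‖) :=
        (tendsto_fst.mono_right (inf_le_left.trans nhdsWithin_le_nhds)).norm
      exact h.eventually_le_const (by norm_num)
    refine exists_isBigO_eq_exp_add (hid.comp tendsto_snd) (hε'.mono fun p h => h.1.le) (C := C) ?_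
    filter_upwards [hε', hx'] with p h1 h2
    refine hC p.1 h2 (fun s hs => ?_) p.2 h1.1 h1.2
    -- for `‖x‖ ≤ 1/2` the whole disc is uniformly far from the cut, whatever the angle
    have h3 : ‖(s : ℂ) * p.1‖ ≤ 1 / 2 := by
      rw [norm_mul, Complex.norm_real, Real.norm_of_nonneg hs.1]
      nlinarith [hs.2, norm_nonneg p.1]
    have h4 := norm_sub_norm_le (1 : ℂ) ((s : ℂ) * p.1)
    rw [norm_one] at h4
    linarith
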